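/- A \emph{cube complex} $X$ is a set of vertices together with a collection of finite subsets, called cubes, such that every singleton is a cube, any two cubes are either disjoint or intersect in a cube, and for every cube $C$ there are an integer $n\ge 0$ and a bijection from $C$ to the vertices of $[0,1]^n$ under which the cubes contained in $C$ correspond precisely to the vertex sets of the faces (of all dimensions) of $[0,1]^n$. Cubes with $2$ elements are called edges and cubes with $4$ elements are called squares. The geometric realization of $X$ is obtained by replacing every cube by a Euclidean unit cube, glued along common faces; the distance between two of its points is the infimum of the lengths of the piecewise straight paths joining them, each of whose straight pieces lies in a single cube. $X$ (possibly infinite-dimensional) is a \emph{$\mathrm{CAT}(0)$ cube complex} if its geometric realization is a $\mathrm{CAT}(0)$ metric space, i.e. a geodesic metric space in which no geodesic triangle is thicker than its Euclidean comparison triangle. An \emph{edge-path} from $x$ to $y$ is a finite sequence of vertices $v_0,\dots,v_n$ ($n\ge 0$) with $v_0=x$, $v_n=y$ and every $\{v_i,v_{i+1}\}$ an edge. A \emph{corner move} replaces a string $u,v,w$ of consecutive vertices of an edge-path by $u,v',w$, where $\{u,v,v',w\}$ is a square. A \emph{simple cancellation} replaces a string $v,v',v$ by the single vertex $v$. \textbf{Proposition.}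 Let $X$ be a $\mathrm{CAT}(0)$ cube complex, let $x,y$ be vertices of $X$, and let $p,q$ be edge-paths from $x$ to $y$. Then $p$ and $q$ are related by a finite sequence of corner moves and simple cancellations: there are edge-paths $p=p_0,p_1,\dots,p_k=q$ from $x$ to $y$ such that for every $i<k$ one of $p_i,p_{i+1}$ is obtained from the other by a corner move or a simple cancellation. -/

import Mathlib

open scoped ENNReal

/-- The vertex sets of the faces (of all dimensions) of the standard cube `[0,1]^n`. A vertex of
`[0,1]^n` is written as a function `Fin n → Bool` (`true` for the coordinate `1`, `false` for the
coordinate `0`); a face is obtained by fixing the coordinates in some set `I` of indices. -/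
def IsStdCubeFace {n : ℕ} (F : Set (Fin n → Bool)) : Prop :=
  ∃ (I : Set (Fin n)) (a : Fin n → Bool), F = {b | ∀ i ∈ I, b i = a i}

/-- `c` is a bijection from the vertices of the standard cube `[0,1]^n` onto the set `C`, under
which the members of `cubes` that are contained in `C` correspond precisely to the faces of the
standard cube. (The subsets of `C` are the sets `c '' F`.) -/
structure IsCubeChart {V : Type*} (cubes : Set (Set V)) (C : Set V) {n : ℕ}
    (c : (Fin n → Bool) → V) : Prop where
  injective : Function.Injective c
  range_eq : Set.range c = C
  image_mem_iff : ∀ F : Set (Fin n → Bool), c '' F ∈ cubes ↔ IsStdCubeFace F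

/-- A cube complex with vertex set `V`. Two cubes may be disjoint; otherwise they meet in a cube. -/
structure CubeComplex (V : Type*) where
  cubes : Set (Set V)
  finite_of_mem : ∀ C ∈ cubes, C.Finite
  singleton_mem : ∀ v : V, {v} ∈ cubes
  inter_mem : ∀ C ∈ cubes, ∀ D ∈ cubes, (C ∩ D).Nonempty → C ∩ D ∈ cubes
  exists_chart : ∀ C ∈ cubes, ∃ (n : ℕ) (c : (Fin n → Bool) → V), IsCubeChart cubes C c

/-- A point `t` of the standard cube, placed in a cube with the vertices `c a`, is recorded by its
vertex weights: the vertex `c a` has weight `∏ i, (t i or 1 - t i)`, with `t i` where `a i = 1` and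
`1 - t i` where `a i = 0`; all other elements of `V` have weight `0`. The weights determine `t`,
and the vertices of non-zero weight are those of the smallest face that contains `t`. -/
noncomputable def vertexWeight {V : Type*} {n : ℕ} (c : (Fin n → Bool) → V)
    (t : EuclideanSpace ℝ (Fin n)) : V → ℝ :=
  Function.extend c (fun a => ∏ i, if a i = true then t i else 1 - t i) 0

/-- The unit cube `[0,1]^n` in Euclidean space. -/
def stdCube (n : ℕ) : Set (EuclideanSpace ℝ (Fin n)) :=
  {t | ∀ i, t i ∈ Set.Icc (0 : ℝ) 1}

/-- The map `γ`, on the interval `[0,1]`, is a geodesic from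
`x` to `y`, parametrised proportionally to arc length. -/
structure IsGeodesicFromTo {α : Type*} [MetricSpace α] (x y : α) (γ : ℝ → α) : Prop where
  map_zero : γ 0 = x
  map_one : γ 1 = y
  dist_eq : ∀ s ∈ Set.Icc (0 : ℝ) 1, ∀ t ∈ Set.Icc (0 : ℝ) 1,
    dist (γ s) (γ t) = |s - t| * dist x y

/-- A `CAT(0)` metric space: any two points are joined by a geodesic, and no geodesic triangle is
thicker than its comparison triangle `x'`, `y'`, `z'` in the Euclidean plane. Any two sides of a
triangle have a common vertex, here called `x`; the comparison points of `γ s` and `δ t` are the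
points that divide the sides `[x', y']` and `[x', z']` in the same proportion. -/
structure IsCAT0Space (α : Type*) [MetricSpace α] : Prop where
  exists_geodesic : ∀ x y : α, ∃ γ : ℝ → α, IsGeodesicFromTo x y γ
  comparison : ∀ (x y z : α) (γ δ : ℝ → α), IsGeodesicFromTo x y γ → IsGeodesicFromTo x z δ →
    ∀ x' y' z' : EuclideanSpace ℝ (Fin 2),
      dist x' y' = dist x y → dist x' z' = dist x z → dist y' z' = dist y z →
      ∀ s ∈ Set.Icc (0 : ℝ) 1, ∀ t ∈ Set.Icc (0 : ℝ) 1,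
        dist (γ s) (δ t) ≤ dist (AffineMap.lineMap x' y' s) (AffineMap.lineMap x' z' t)

namespace CubeComplex

/-- The geometric realization: every cube is replaced by a Euclidean unit cube, and cubes are glued
along common faces. A point is given by its vertex weights; two points of two cubes are glued
exactly when they are the same point of a common face, i.e. when their vertex weights agree. -/
structure Realization {V : Type*} (X : CubeComplex V) where
  weight : V → ℝ
  exists_cube : ∃ C ∈ X.cubes, ∃ (n : ℕ) (c : (Fin n → Bool) → V), IsCubeChart X.cubes C c ∧
    ∃ t ∈ stdCube n, weight = vertexWeight c t

/-- The Euclidean distance between two points that lie in a common cube (computed in any common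
cube, with any of its charts), and `∞` for two points that lie in no common cube. -/
noncomputable def cubeDist {V : Type*} (X : CubeComplex V) (p q : X.Realization) : ℝ≥0∞ :=
  sInf {r | ∃ C ∈ X.cubes, ∃ (n : ℕ) (c : (Fin n → Bool) → V), IsCubeChart X.cubes C c ∧
    ∃ s ∈ stdCube n, ∃ t ∈ stdCube n,
      p.weight = vertexWeight c s ∧ q.weight = vertexWeight c t ∧ r = edist s t}

/-- The natural (length) distance on the geometric realization: the infimum of the lengths of the
piecewise straight paths `p = x 0, x 1, …, x m = q` whose consecutive points lie in a common cube.
It is `∞` if there is no such path. -/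
noncomputable def lengthDist {V : Type*} (X : CubeComplex V) (p q : X.Realization) : ℝ≥0∞ :=
  sInf {r | ∃ (m : ℕ) (x : ℕ → X.Realization), x 0 = p ∧ x m = q ∧
    r = ∑ i ∈ Finset.range m, X.cubeDist (x i) (x (i + 1))}

/-- A `CAT(0)` cube complex: the natural distance on the geometric realization is a (finite)
metric, and with this metric the geometric realization is a `CAT(0)` metric space. -/
def IsCAT0 {V : Type*} (X : CubeComplex V) : Prop :=
  ∃ _ : MetricSpace X.Realization,
    (∀ p q : X.Realization, edist p q = X.lengthDist p q) ∧ IsCAT0Space X.Realization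

/-- The edges are the cubes with two elements. -/
def IsEdge {V : Type*} (X : CubeComplex V) (e : Set V) : Prop :=
  e ∈ X.cubes ∧ e.ncard = 2

/-- The squares are the cubes with four elements. -/
def IsSquare {V : Type*} (X : CubeComplex V) (S : Set V) : Prop :=
  S ∈ X.cubes ∧ S.ncard = 4

/-- An edge-path from `x` to `y`: a sequence of vertices `v₀, …, vₙ` (`n ≥ 0`) with `v₀ = x` and
`vₙ = y` such that each `{vᵢ, vᵢ₊₁}` is an edge. -/
structure EdgePath {V : Type*} (X : CubeComplex V) (x y : V) where
  verts : List V
  head_eq : verts.head? = some x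
  last_eq : verts.getLast? = some y
  chain : verts.IsChain (fun u v => X.IsEdge {u, v})

/-- A corner move replaces a string `u, v, w` by `u, v', w`, where `{u, v, v', w}` is a square. -/
def CornerMove {V : Type*} (X : CubeComplex V) {x y : V} (p q : X.EdgePath x y) : Prop :=
  ∃ (a b : List V) (u v v' w : V), X.IsSquare {u, v, v', w} ∧
    p.verts = a ++ [u, v, w] ++ b ∧ q.verts = a ++ [u, v', w] ++ b

/-- A simple cancellation replaces a string `v, v', v` by the string `v`. -/
def SimpleCancellation {V : Type*} (X : CubeComplex V) {x y : V} (p q : X.EdgePath x y) : Prop :=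
  ∃ (a b : List V) (v v' : V),
    p.verts = a ++ [v, v', v] ++ b ∧ q.verts = a ++ [v] ++ b

end CubeComplex

/-! Geodesics from `x` contract the complex to `x`, and this contraction is made combinatorial. A
vertex `v` is deep at a point `p` if every cube avoiding `v` carries little of the vertex weight of
`p`. Rounding coordinates gives each point a vertex of depth `1/2` (`exists_isDeep`). Depth drops by
at most the distance travelled, so a vertex of depth `1/2` at `p` lies in every cube carrying a
point at distance less than `1/2` from `p` (`exists_cube_of_dist_lt`). Facets are handled one
coordinate at a time, so no constant depends on the dimension.

Sampling a geodesic from `x` to `q` and rounding the samples gives a tracked walk. By the CAT(0)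
inequality, geodesics from `x` to points at most `1/3` apart stay that close, so the two rounded
sequences bound a ladder of triangles, each inside a cube. Inside a cube, walks with common
endpoints are homotopic, by sorting and cancelling directions. Hence tracked walks to nearby points
are homotopic (`IsTracked.walkHomotopic`), and a tracked walk to `u` followed by any walk from `u`
to `v` is homotopic to a tracked walk to `v`, provided the sampling is fine enough. Applied to `p`
and `q` behind one tracked loop at `x`, this gives the result after left cancellation. -/

namespace CubeComplex

/-! ### Homotopy of walks and its translation to edge-paths. -/

/-- The graph of vertices and edges of a cube complex. -/
def edgeGraph {V : Type*} (X : CubeComplex V) : SimpleGraph V where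
  Adj u v := X.IsEdge {u, v}
  symm := ⟨fun u v h => by rwa [Set.pair_comm]⟩
  loopless := ⟨fun v h => by simpa using h.2⟩

/-- Homotopy of walks, generated by corner moves and simple cancellations. -/
inductive WalkHomotopic {V : Type*} (X : CubeComplex V) :
    ∀ {u v : V}, X.edgeGraph.Walk u v → X.edgeGraph.Walk u v → Prop
  | refl {u v : V} (p : X.edgeGraph.Walk u v) : WalkHomotopic X p p
  | symm {u v : V} {p q : X.edgeGraph.Walk u v} : WalkHomotopic X p q → WalkHomotopic X q p
  | trans {u v : V} {p q r : X.edgeGraph.Walk u v} :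
      WalkHomotopic X p q → WalkHomotopic X q r → WalkHomotopic X p r
  | cons {u v w : V} (h : X.edgeGraph.Adj u v) {p q : X.edgeGraph.Walk v w} :
      WalkHomotopic X p q → WalkHomotopic X (.cons h p) (.cons h q)
  | cancel {u v w : V} (h : X.edgeGraph.Adj u v) (h' : X.edgeGraph.Adj v u)
      (p : X.edgeGraph.Walk u w) : WalkHomotopic X (.cons h (.cons h' p)) p
  | corner {u v v' w z : V} (h₁ : X.edgeGraph.Adj u v) (h₂ : X.edgeGraph.Adj v w)
      (h₁' : X.edgeGraph.Adj u v') (h₂' : X.edgeGraph.Adj v' w) (p : X.edgeGraph.Walk w z) :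
      X.IsSquare {u, v, v', w} →
      WalkHomotopic X (.cons h₁ (.cons h₂ p)) (.cons h₁' (.cons h₂' p))

section Walks

variable {V : Type*} {X : CubeComplex V}

theorem WalkHomotopic.append_right {u v w : V} {p q : X.edgeGraph.Walk u v}
    (h : X.WalkHomotopic p q) (r : X.edgeGraph.Walk v w) :
    X.WalkHomotopic (p.append r) (q.append r) := by
  induction h with
  | refl p => exact .refl _
  | symm _ ih => exact (ih r).symm
  | trans _ _ ih₁ ih₂ => exact (ih₁ r).trans (ih₂ r)
  | cons h _ ih => exact (ih r).cons h
  | cancel h h' p => exact .cancel h h' _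
  | corner h₁ h₂ h₁' h₂' p hs => exact .corner h₁ h₂ h₁' h₂' _ hs

theorem WalkHomotopic.append_left {u v w : V} (r : X.edgeGraph.Walk u v)
    {p q : X.edgeGraph.Walk v w} (h : X.WalkHomotopic p q) :
    X.WalkHomotopic (r.append p) (r.append q) := by
  induction r with
  | nil => exact h
  | cons h' r ih => exact (ih h).cons h'

theorem walkHomotopic_reverse_append {u v : V} (p : X.edgeGraph.Walk u v) :
    X.WalkHomotopic (p.reverse.append p) .nil := by
  induction p with
  | nil => exact .refl _
  | cons h p ih =>
    rw [SimpleGraph.Walk.reverse_cons, ← SimpleGraph.Walk.append_assoc,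
      SimpleGraph.Walk.cons_append, SimpleGraph.Walk.nil_append]
    exact ((WalkHomotopic.cancel h.symm h p).append_left p.reverse).trans ih

theorem WalkHomotopic.of_append_left {u v w : V} {r : X.edgeGraph.Walk u v}
    {p q : X.edgeGraph.Walk v w} (h : X.WalkHomotopic (r.append p) (r.append q)) :
    X.WalkHomotopic p q := by
  have h1 := fun s : X.edgeGraph.Walk v w =>
    (walkHomotopic_reverse_append r).append_right s
  simp only [← SimpleGraph.Walk.append_assoc, SimpleGraph.Walk.nil_append] at h1
  exact (h1 p).symm.trans ((h.append_left r.reverse).trans (h1 q))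

/-- The edge-path traversed by a walk. -/
def walkEdgePath {u v : V} (p : X.edgeGraph.Walk u v) : X.EdgePath u v where
  verts := p.support
  head_eq := by cases p <;> simp
  last_eq := by
    rw [List.getLast?_eq_getLast_of_ne_nil p.support_ne_nil, SimpleGraph.Walk.getLast_support]
  chain := p.isChain_adj_support

theorem EdgePath.ext_verts {x y : V} {p q : X.EdgePath x y} (h : p.verts = q.verts) : p = q := by
  cases p; cases q; cases h; rfl

theorem exists_walk_of_chain (l : List V) (hl : l.IsChain (fun u v => X.IsEdge {u, v})) (x y : V)
    (hx : l.head? = some x) (hy : l.getLast? = some y) :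
    ∃ p : X.edgeGraph.Walk x y, p.support = l := by
  induction l generalizing x with
  | nil => simp at hx
  | cons a l ih =>
    obtain rfl : a = x := by simpa using hx
    cases l with
    | nil =>
      obtain rfl : a = y := by simpa using hy
      exact ⟨.nil, rfl⟩
    | cons b l =>
      rw [List.isChain_cons_cons] at hl
      obtain ⟨p, hp⟩ := ih hl.2 b rfl (by simpa using hy)
      have hab : X.edgeGraph.Adj a b := hl.1
      exact ⟨.cons hab p, by simp [hp]⟩

theorem exists_walkEdgePath_eq {x y : V} (p : X.EdgePath x y) :
    ∃ w : X.edgeGraph.Walk x y, walkEdgePath w = p := by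
  obtain ⟨w, hw⟩ := exists_walk_of_chain p.verts p.chain x y p.head_eq p.last_eq
  exact ⟨w, EdgePath.ext_verts hw⟩

/-- An edge-path with an edge put in front of it. -/
def EdgePath.consEdge {u v w : V} (h : X.edgeGraph.Adj u v) (p : X.EdgePath v w) :
    X.EdgePath u w where
  verts := u :: p.verts
  head_eq := rfl
  last_eq := by
    have h1 := p.head_eq
    have h2 := p.last_eq
    cases hp : p.verts with
    | nil => simp [hp] at h1
    | cons a l => simpa [hp] using h2
  chain := by
    refine List.IsChain.cons p.chain fun a ha => ?_
    rw [p.head_eq] at ha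
    obtain rfl : v = a := by simpa using ha
    exact h

theorem WalkHomotopic.eqvGen {u v : V} {p q : X.edgeGraph.Walk u v} (h : X.WalkHomotopic p q) :
    Relation.EqvGen (fun p q : X.EdgePath u v => X.CornerMove p q ∨ X.SimpleCancellation p q)
      (walkEdgePath p) (walkEdgePath q) := by
  induction h with
  | refl p => exact .refl _
  | symm _ ih => exact ih.symm
  | trans _ _ ih₁ ih₂ => exact ih₁.trans _ _ _ ih₂
  | @cons u v w h p q _ ih =>
    -- The induction on `EqvGen` needs free endpoints, which need not be presented as edge-paths of
    -- walks.
    have key : ∀ p q : X.EdgePath v w, Relation.EqvGen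
        (fun p q : X.EdgePath v w => X.CornerMove p q ∨ X.SimpleCancellation p q) p q →
        Relation.EqvGen (fun p q : X.EdgePath u w => X.CornerMove p q ∨ X.SimpleCancellation p q)
          (p.consEdge h) (q.consEdge h) := by
      intro p q hpq
      induction hpq with
      | refl p => exact .refl _
      | symm _ _ _ ih => exact ih.symm
      | trans _ _ _ _ _ ih₁ ih₂ => exact ih₁.trans _ _ _ ih₂
      | rel p q hpq =>
        refine .rel _ _ ?_
        rcases hpq with ⟨a, b, s, t, t', z, hS, hp, hq⟩ | ⟨a, b, s, t, hp, hq⟩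
        · exact .inl ⟨u :: a, b, s, t, t', z, hS, by simp [EdgePath.consEdge, hp],
            by simp [EdgePath.consEdge, hq]⟩
        · exact .inr ⟨u :: a, b, s, t, by simp [EdgePath.consEdge, hp],
            by simp [EdgePath.consEdge, hq]⟩
    exact key _ _ ih
  | @cancel u v w h h' p =>
    refine .rel _ _ (.inr ⟨[], p.support.tail, u, v, ?_, ?_⟩)
    · simp [walkEdgePath]
    · simp [walkEdgePath]
  | @corner u v v' w z h₁ h₂ h₁' h₂' p hs =>
    refine .rel _ _ (.inl ⟨[], p.support.tail, u, v, v', w, hs, ?_, ?_⟩)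
    · simp [walkEdgePath]
    · simp [walkEdgePath]

end Walks

end CubeComplex

/-! ### Words of coordinate flips in the standard cube. -/

/-- The neighbour of a vertex of the standard cube in direction `i`. -/
def flipAt {n : ℕ} (i : Fin n) (a : Fin n → Bool) : Fin n → Bool :=
  Function.update a i (!a i)

theorem flipAt_same {n : ℕ} (i : Fin n) (a : Fin n → Bool) : flipAt i a i = !a i := by
  simp [flipAt]

theorem flipAt_of_ne {n : ℕ} {i j : Fin n} (h : j ≠ i) (a : Fin n → Bool) :
    flipAt i a j = a j := by
  simp [flipAt, h]

theorem flipAt_flipAt {n : ℕ} (i : Fin n) (a : Fin n → Bool) : flipAt i (flipAt i a) = a := by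
  simp [flipAt]

theorem flipAt_comm {n : ℕ} (i j : Fin n) (a : Fin n → Bool) :
    flipAt i (flipAt j a) = flipAt j (flipAt i a) := by
  rcases eq_or_ne i j with rfl | h
  · rfl
  · ext k
    simp only [flipAt, Function.update_apply]
    grind

theorem flipAt_ne {n : ℕ} (i : Fin n) (a : Fin n → Bool) : flipAt i a ≠ a := fun h => by
  have := congrFun h i
  simp [flipAt_same] at this

/-- The vertices met when the directions of the word `w` are followed, starting at `a`. -/
def flipWord {V : Type*} {n : ℕ} (c : (Fin n → Bool) → V) :
    List (Fin n) → (Fin n → Bool) → List V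
  | [], a => [c a]
  | i :: w, a => c a :: flipWord c w (flipAt i a)

theorem head?_flipWord {V : Type*} {n : ℕ} (c : (Fin n → Bool) → V) (w : List (Fin n))
    (a : Fin n → Bool) : (flipWord c w a).head? = some (c a) := by
  cases w <;> rfl

theorem getLast?_flipWord {V : Type*} {n : ℕ} (c : (Fin n → Bool) → V) (w : List (Fin n))
    (a : Fin n → Bool) :
    (flipWord c w a).getLast? = some (c (w.foldl (fun a i => flipAt i a) a)) := by
  induction w generalizing a with
  | nil => rfl
  | cons i w ih =>
    have h := ih (flipAt i a)
    rw [flipWord, List.foldl_cons, ← h]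
    cases hl : flipWord c w (flipAt i a) with
    | nil => simp [hl] at h
    | cons b l => simp

theorem foldl_flipAt_apply {n : ℕ} (w : List (Fin n)) (a : Fin n → Bool) (j : Fin n) :
    w.foldl (fun a i => flipAt i a) a j = (a j).xor (decide (w.count j % 2 = 1)) := by
  induction w generalizing a with
  | nil => simp
  | cons i w ih =>
    rw [List.foldl_cons, ih]
    rcases eq_or_ne i j with rfl | h
    · rw [flipAt_same, List.count_cons_self]
      rcases Nat.mod_two_eq_zero_or_one (w.count i) with h | h <;> cases a i <;>
        simp [Nat.add_mod, h]
    · rw [flipAt_of_ne h.symm, List.count_cons_of_ne h]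

theorem exists_foldl_flipAt_eq {n : ℕ} (a b : Fin n → Bool) :
    ∃ w : List (Fin n), w.foldl (fun a i => flipAt i a) a = b := by
  refine ⟨(Finset.univ.filter fun i => a i ≠ b i).toList, funext fun j => ?_⟩
  rw [foldl_flipAt_apply]
  by_cases h : a j = b j
  · rw [List.count_eq_zero_of_not_mem (by simpa using h)]
    simp [h]
  · rw [List.count_eq_one_of_mem (Finset.nodup_toList _) (by simpa using h)]
    revert h
    cases a j <;> cases b j <;> simp

/-! ### Walks inside a single cube. -/

namespace CubeComplex

section Hypercube

variable {V : Type*} {X : CubeComplex V}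

theorem chart_adj {C : Set V} {n : ℕ} {c : (Fin n → Bool) → V} (hc : IsCubeChart X.cubes C c)
    (a : Fin n → Bool) (i : Fin n) : X.edgeGraph.Adj (c a) (c (flipAt i a)) := by
  refine ⟨?_, Set.ncard_pair fun h => flipAt_ne i a (hc.injective h).symm⟩
  rw [← Set.image_pair, hc.image_mem_iff]
  refine ⟨{i}ᶜ, a, ?_⟩
  ext b
  simp only [Set.mem_insert_iff, Set.mem_singleton_iff, Set.mem_compl_iff, Set.mem_ofPred_eq]
  constructor
  · rintro (rfl | rfl) j hj
    · rfl
    · exact flipAt_of_ne hj a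
  · intro h
    by_cases hb : b i = a i
    · left
      ext j
      by_cases hj : j = i
      · rw [hj, hb]
      · rw [h j hj]
    · right
      ext j
      by_cases hj : j = i
      · rw [hj, flipAt_same]
        revert hb
        cases a i <;> cases b i <;> simp
      · rw [h j hj, flipAt_of_ne hj]

/-- If `a` and `b` differ at `i`, the face `{a, b}` leaves coordinate `i` free, so it contains
`flipAt i a`, which must be `b`. -/
theorem exists_flipAt_of_adj {C : Set V} {n : ℕ} {c : (Fin n → Bool) → V}
    (hc : IsCubeChart X.cubes C c) {a b : Fin n → Bool} (h : X.edgeGraph.Adj (c a) (c b)) :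
    ∃ i, b = flipAt i a := by
  have hab : a ≠ b := fun hab => h.ne (congrArg c hab)
  have h1 := h.1
  rw [← Set.image_pair, hc.image_mem_iff] at h1
  obtain ⟨I, d, hI⟩ := h1
  obtain ⟨i, hi⟩ := Function.ne_iff.1 hab
  have ha : a ∈ ({a, b} : Set (Fin n → Bool)) := by simp
  have hb : b ∈ ({a, b} : Set (Fin n → Bool)) := by simp
  have hf : flipAt i a ∈ ({a, b} : Set (Fin n → Bool)) := by
    rw [hI] at ha hb ⊢
    intro j hj
    have hji : j ≠ i := by
      rintro rfl
      exact hi ((ha j hj).trans (hb j hj).symm)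
    rw [flipAt_of_ne hji]
    exact ha j hj
  rcases hf with hf | hf
  · exact absurd hf (flipAt_ne i a)
  · exact ⟨i, hf.symm⟩

theorem chart_square {C : Set V} {n : ℕ} {c : (Fin n → Bool) → V} (hc : IsCubeChart X.cubes C c)
    (a : Fin n → Bool) {i j : Fin n} (hij : i ≠ j) :
    X.IsSquare {c a, c (flipAt i a), c (flipAt j a), c (flipAt j (flipAt i a))} := by
  have hset : ({c a, c (flipAt i a), c (flipAt j a), c (flipAt j (flipAt i a))} : Set V) =
      c '' {a, flipAt i a, flipAt j a, flipAt j (flipAt i a)} := by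
    simp only [Set.image_insert_eq, Set.image_singleton]
  rw [hset]
  have e1 : flipAt i a i = !a i := flipAt_same i a
  have e2 : flipAt i a j = a j := flipAt_of_ne hij.symm a
  have e3 : flipAt j a i = a i := flipAt_of_ne hij a
  have e4 : flipAt j a j = !a j := flipAt_same j a
  have e5 : flipAt j (flipAt i a) i = !a i := by rw [flipAt_of_ne hij, e1]
  have e6 : flipAt j (flipAt i a) j = !a j := by rw [flipAt_same, e2]
  constructor
  · rw [hc.image_mem_iff]
    refine ⟨{i, j}ᶜ, a, ?_⟩
    ext b
    simp only [Set.mem_insert_iff, Set.mem_singleton_iff, Set.mem_compl_iff, Set.mem_ofPred_eq]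
    constructor
    · rintro (rfl | rfl | rfl | rfl) k hk
      · rfl
      · exact flipAt_of_ne (by tauto) a
      · exact flipAt_of_ne (by tauto) a
      · rw [flipAt_of_ne (by tauto), flipAt_of_ne (by tauto)]
    · intro h
      have key : ∀ d : Fin n → Bool, d i = b i → d j = b j →
          (∀ k, k ≠ i → k ≠ j → d k = a k) → b = d := by
        intro d hi hj hk
        ext k
        by_cases h1 : k = i
        · rw [h1, hi]
        by_cases h2 : k = j
        · rw [h2, hj]
        rw [hk k h1 h2, h k (by tauto)]
      rcases Bool.eq_or_eq_not (b i) (a i) with hi | hi <;>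
        rcases Bool.eq_or_eq_not (b j) (a j) with hj | hj
      · exact .inl (key _ hi.symm hj.symm fun _ _ _ => rfl)
      · exact .inr (.inr (.inl (key _ (by rw [e3, hi]) (by rw [e4, hj])
          fun k _ h2 => flipAt_of_ne h2 a)))
      · exact .inr (.inl (key _ (by rw [e1, hi]) (by rw [e2, hj])
          fun k h1 _ => flipAt_of_ne h1 a))
      · exact .inr (.inr (.inr (key _ (by rw [e5, hi]) (by rw [e6, hj])
          fun k h1 h2 => by rw [flipAt_of_ne h2, flipAt_of_ne h1])))
  · rw [Set.ncard_image_of_injective _ hc.injective]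
    have n1 : a ≠ flipAt i a := (flipAt_ne i a).symm
    have n2 : a ≠ flipAt j a := (flipAt_ne j a).symm
    have n3 : a ≠ flipAt j (flipAt i a) := fun h => by
      have := congrFun h i
      simp [e5] at this
    have n4 : flipAt i a ≠ flipAt j a := fun h => by
      have := congrFun h i
      simp [e1, e3] at this
    have n5 : flipAt i a ≠ flipAt j (flipAt i a) := (flipAt_ne j _).symm
    have n6 : flipAt j a ≠ flipAt j (flipAt i a) := fun h => by
      have := congrFun h i
      simp [e3, e5] at this
    rw [Set.ncard_insert_of_notMem (by simp [n1, n2, n3]),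
      Set.ncard_insert_of_notMem (by simp [n4, n5]), Set.ncard_pair n6]

theorem exists_eq_cons_of_support_eq_flipWord {C : Set V} {n : ℕ} {c : (Fin n → Bool) → V}
    (hc : IsCubeChart X.cubes C c) {a : Fin n → Bool} {y : V} {i : Fin n} {w : List (Fin n)}
    (p : X.edgeGraph.Walk (c a) y) (hp : p.support = flipWord c (i :: w) a) :
    ∃ p' : X.edgeGraph.Walk (c (flipAt i a)) y, p'.support = flipWord c w (flipAt i a) ∧
      p = .cons (chart_adj hc a i) p' := by
  have hh := head?_flipWord c w (flipAt i a)
  cases p with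
  | nil =>
    simp only [SimpleGraph.Walk.support_nil, flipWord, List.cons.injEq, true_and] at hp
    simp [← hp] at hh
  | cons h p =>
    simp only [SimpleGraph.Walk.support_cons, flipWord, List.cons.injEq, true_and] at hp
    rw [← hp, ← SimpleGraph.Walk.cons_tail_support, List.head?_cons, Option.some_inj] at hh
    subst hh
    exact ⟨p, hp, rfl⟩

/-- Swapping two distinct adjacent letters is a corner move across the square they span. -/
theorem exists_walkHomotopic_of_perm {C : Set V} {n : ℕ} {c : (Fin n → Bool) → V}
    (hc : IsCubeChart X.cubes C c) {w w' : List (Fin n)} (hw : w.Perm w') {a : Fin n → Bool}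
    {y : V} (p : X.edgeGraph.Walk (c a) y) (hp : p.support = flipWord c w a) :
    ∃ q : X.edgeGraph.Walk (c a) y, q.support = flipWord c w' a ∧ X.WalkHomotopic p q := by
  induction hw generalizing a with
  | nil => exact ⟨p, hp, .refl p⟩
  | cons i _ ih =>
    obtain ⟨p', hp', rfl⟩ := exists_eq_cons_of_support_eq_flipWord hc p hp
    obtain ⟨q, hq, h⟩ := ih p' hp'
    exact ⟨.cons (chart_adj hc a i) q, by simp [flipWord, hq], h.cons _⟩
  | trans _ _ ih₁ ih₂ =>
    obtain ⟨q, hq, h⟩ := ih₁ p hp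
    obtain ⟨r, hr, h'⟩ := ih₂ q hq
    exact ⟨r, hr, h.trans h'⟩
  | swap i j w =>
    rcases eq_or_ne i j with rfl | hij
    · exact ⟨p, hp, .refl p⟩
    obtain ⟨p', hp', rfl⟩ := exists_eq_cons_of_support_eq_flipWord hc p hp
    obtain ⟨p'', hp'', rfl⟩ := exists_eq_cons_of_support_eq_flipWord hc p' hp'
    have hadj : X.edgeGraph.Adj (c (flipAt i a)) (c (flipAt i (flipAt j a))) := by
      rw [flipAt_comm]
      exact chart_adj hc _ j
    refine ⟨.cons (chart_adj hc a i) (.cons hadj p''), ?_, ?_⟩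
    · simp [flipWord, hp'', flipAt_comm i j]
    · exact .corner _ _ _ _ _ (chart_square hc a hij.symm)

/-- Equal parities mean equal endpoints. If the first letter recurs, its next copy is moved beside
it and the pair cancels. Otherwise its count is odd, so it also occurs in the other word, is moved
to the front there, and the common first edge is dropped. -/
theorem walkHomotopic_of_flipWord {C : Set V} {n : ℕ} {c : (Fin n → Bool) → V}
    (hc : IsCubeChart X.cubes C c) (k : ℕ) (w w' : List (Fin n)) (hk : w.length + w'.length ≤ k)
    (hcount : ∀ i, w.count i % 2 = w'.count i % 2) (a : Fin n → Bool) {y : V}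
    (p q : X.edgeGraph.Walk (c a) y) (hp : p.support = flipWord c w a)
    (hq : q.support = flipWord c w' a) : X.WalkHomotopic p q := by
  induction k using Nat.strong_induction_on generalizing w w' a with
  | _ k ih =>
  have shorten : ∀ (i : Fin n) (w w' : List (Fin n)), (i :: w).length + w'.length ≤ k →
      (∀ j, (i :: w).count j % 2 = w'.count j % 2) → i ∈ w →
      ∀ p q : X.edgeGraph.Walk (c a) y, p.support = flipWord c (i :: w) a →
        q.support = flipWord c w' a → X.WalkHomotopic p q := by
    intro i w w' hk hcount hi p q hp hq
    obtain ⟨p', hp', hpp'⟩ := exists_walkHomotopic_of_perm hc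
      ((List.perm_cons_erase hi).cons i) p hp
    obtain ⟨r, hr, rfl⟩ := exists_eq_cons_of_support_eq_flipWord hc p' hp'
    obtain ⟨s, hs, rfl⟩ := exists_eq_cons_of_support_eq_flipWord hc r hr
    obtain ⟨s', hs', hss'⟩ : ∃ s' : X.edgeGraph.Walk (c a) y,
        s'.support = flipWord c (w.erase i) a ∧ X.WalkHomotopic
          (.cons (chart_adj hc a i) (.cons (chart_adj hc (flipAt i a) i) s)) s' := by
      -- The walk `s` starts at `c (flipAt i (flipAt i a))`, equal to `c a` only propositionally;
      -- generalizing the adjacency proof lets the rewrite go through.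
      clear hr hp' hpp'
      generalize chart_adj hc (flipAt i a) i = h
      revert h s
      rw [flipAt_flipAt]
      exact fun s hs h => ⟨s, hs, .cancel _ _ s⟩
    refine hpp'.trans (hss'.trans ?_)
    have hlen : (w.erase i).length + 1 = w.length := by
      rw [List.length_erase_of_mem hi]
      have := List.length_pos_of_mem hi
      omega
    rw [List.length_cons] at hk
    refine ih (k - 1) (by omega) (w.erase i) w' (by omega) (fun j => ?_) a s' q hs' hq
    rw [← hcount j, ((List.perm_cons_erase hi).cons i).count_eq j]
    simp only [List.count_cons]
    split_ifs <;> omega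
  match w, w' with
  | [], [] =>
    rw [SimpleGraph.Walk.ext_support (hp.trans hq.symm)]
    exact .refl _
  | i :: w, w' =>
    by_cases hi : i ∈ w
    · exact shorten i w w' hk hcount hi p q hp hq
    · have hi' : i ∈ w' := by
        by_contra hi'
        have := hcount i
        rw [List.count_cons_self, List.count_eq_zero_of_not_mem hi,
          List.count_eq_zero_of_not_mem hi'] at this
        simp at this
      obtain ⟨q', hq', hqq'⟩ := exists_walkHomotopic_of_perm hc (List.perm_cons_erase hi') q hq
      obtain ⟨r, hr, rfl⟩ := exists_eq_cons_of_support_eq_flipWord hc p hp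
      obtain ⟨s, hs, rfl⟩ := exists_eq_cons_of_support_eq_flipWord hc q' hq'
      refine WalkHomotopic.trans ?_ hqq'.symm
      have hlen : (w'.erase i).length + 1 = w'.length := by
        rw [List.length_erase_of_mem hi']
        have := List.length_pos_of_mem hi'
        omega
      rw [List.length_cons] at hk
      refine .cons _ (ih (k - 1) (by omega) w (w'.erase i) (by omega) (fun j => ?_)
        (flipAt i a) r s hr hs)
      have := hcount j
      rw [(List.perm_cons_erase hi').count_eq j] at this
      simp only [List.count_cons] at this
      split_ifs at this <;> omega
  | [], i :: w' =>
    -- Every letter now has even count, so the first one recurs.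
    have hi' : i ∈ w' := by
      by_contra hi'
      have := hcount i
      rw [List.count_cons_self, List.count_eq_zero_of_not_mem hi', List.count_nil] at this
      simp at this
    exact (shorten i w' [] (by simpa using hk) (fun j => (hcount j).symm) hi' q p hq hp).symm

theorem exists_support_eq_flipWord {C : Set V} {n : ℕ} {c : (Fin n → Bool) → V}
    (hc : IsCubeChart X.cubes C c) {x y : V} (p : X.edgeGraph.Walk x y)
    (hp : ∀ v ∈ p.support, v ∈ C) {a : Fin n → Bool} (ha : c a = x) :
    ∃ w, p.support = flipWord c w a := by
  induction p generalizing a with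
  | nil => exact ⟨[], by simp [flipWord, ha]⟩
  | @cons u v z h p ih =>
    have hv : v ∈ C := hp v (by simp)
    rw [← hc.range_eq] at hv
    obtain ⟨b, rfl⟩ := hv
    subst ha
    obtain ⟨i, rfl⟩ := exists_flipAt_of_adj hc h
    obtain ⟨w, hw⟩ := ih (fun v hv => hp v (by simp [hv])) rfl
    exact ⟨i :: w, by simp [flipWord, hw]⟩

theorem exists_walk_support_subset {C : Set V} (hC : C ∈ X.cubes) {u v : V} (hu : u ∈ C)
    (hv : v ∈ C) : ∃ p : X.edgeGraph.Walk u v, ∀ z ∈ p.support, z ∈ C := by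
  obtain ⟨n, c, hc⟩ := X.exists_chart C hC
  rw [← hc.range_eq] at hu hv ⊢
  obtain ⟨a, rfl⟩ := hu
  obtain ⟨b, rfl⟩ := hv
  obtain ⟨w, rfl⟩ := exists_foldl_flipAt_eq a b
  clear hC
  induction w generalizing a with
  | nil => exact ⟨.nil, by simp⟩
  | cons i w ih =>
    obtain ⟨p, hp⟩ := ih (flipAt i a)
    refine ⟨.cons (chart_adj hc a i) p, ?_⟩
    simpa using hp

theorem walkHomotopic_of_support_subset {C : Set V} (hC : C ∈ X.cubes) {u v : V}
    (p q : X.edgeGraph.Walk u v) (hp : ∀ z ∈ p.support, z ∈ C) (hq : ∀ z ∈ q.support, z ∈ C) :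
    X.WalkHomotopic p q := by
  obtain ⟨n, c, hc⟩ := X.exists_chart C hC
  have hu := hp u p.start_mem_support
  rw [← hc.range_eq] at hu
  obtain ⟨a, rfl⟩ := hu
  obtain ⟨w, hw⟩ := exists_support_eq_flipWord hc p hp rfl
  obtain ⟨w', hw'⟩ := exists_support_eq_flipWord hc q hq rfl
  have hlast : ∀ {w} {p : X.edgeGraph.Walk (c a) v}, p.support = flipWord c w a →
      v = c (w.foldl (fun a i => flipAt i a) a) := by
    intro w p hw
    have h := getLast?_flipWord c w a
    rw [← hw, List.getLast?_eq_getLast_of_ne_nil p.support_ne_nil,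
      SimpleGraph.Walk.getLast_support, Option.some_inj] at h
    exact h
  have hend := hc.injective ((hlast hw).symm.trans (hlast hw'))
  refine walkHomotopic_of_flipWord hc _ w w' le_rfl (fun i => ?_) a p q hw hw'
  have hi := congrFun hend i
  rw [foldl_flipAt_apply, foldl_flipAt_apply, Bool.xor_right_inj, decide_eq_decide] at hi
  omega

/-- A walk that stays in a single cube. -/
def IsCubeWalk {u v : V} (p : X.edgeGraph.Walk u v) : Prop :=
  ∃ C ∈ X.cubes, ∀ z ∈ p.support, z ∈ C

/-- The two cubes may differ; both walks are compared with one inside their intersection, again a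
cube. -/
theorem IsCubeWalk.walkHomotopic {u v : V} {p q : X.edgeGraph.Walk u v} (hp : IsCubeWalk p)
    (hq : IsCubeWalk q) : X.WalkHomotopic p q := by
  obtain ⟨C, hC, hpC⟩ := hp
  obtain ⟨D, hD, hqD⟩ := hq
  have hu : u ∈ C ∩ D := ⟨hpC u p.start_mem_support, hqD u q.start_mem_support⟩
  have hv : v ∈ C ∩ D := ⟨hpC v p.end_mem_support, hqD v q.end_mem_support⟩
  obtain ⟨r, hr⟩ := exists_walk_support_subset (X.inter_mem C hC D hD ⟨u, hu⟩) hu hv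
  exact (walkHomotopic_of_support_subset hC p r hpC fun z hz => (hr z hz).1).trans
    (walkHomotopic_of_support_subset hD r q (fun z hz => (hr z hz).2) hqD)

theorem IsCubeWalk.append_walkHomotopic {C : Set V} (hC : C ∈ X.cubes) {u v w : V} (hu : u ∈ C)
    (hv : v ∈ C) (hw : w ∈ C) {p : X.edgeGraph.Walk u v} {q : X.edgeGraph.Walk v w}
    {r : X.edgeGraph.Walk u w} (hp : IsCubeWalk p) (hq : IsCubeWalk q) (hr : IsCubeWalk r) :
    X.WalkHomotopic (p.append q) r := by
  obtain ⟨p', hp'⟩ := exists_walk_support_subset hC hu hv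
  obtain ⟨q', hq'⟩ := exists_walk_support_subset hC hv hw
  refine ((hp.walkHomotopic ⟨C, hC, hp'⟩).append_right q).trans
    (((hq.walkHomotopic ⟨C, hC, hq'⟩).append_left p').trans (IsCubeWalk.walkHomotopic ?_ hr))
  refine ⟨C, hC, fun z hz => ?_⟩
  rw [SimpleGraph.Walk.mem_support_append_iff] at hz
  exact hz.elim (hp' z) (hq' z)

theorem exists_isCubeWalk {C : Set V} (hC : C ∈ X.cubes) {u v : V} (hu : u ∈ C) (hv : v ∈ C) :
    ∃ p : X.edgeGraph.Walk u v, IsCubeWalk p := by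
  obtain ⟨p, hp⟩ := exists_walk_support_subset hC hu hv
  exact ⟨p, C, hC, hp⟩

end Hypercube

end CubeComplex

/-! ### Total vertex weight of faces. -/

/-- The total weight of the elements of `F`. -/
noncomputable def mass {V : Type*} (f : V → ℝ) (F : Set V) : ℝ :=
  ∑ᶠ v, F.indicator f v

/-- The factor that the coordinate `i` of the point `t` contributes to the weight of the vertices
whose coordinate `i` is `x`. -/
def coordWeight {n : ℕ} (t : EuclideanSpace ℝ (Fin n)) (i : Fin n) (x : Bool) : ℝ :=
  if x = true then t i else 1 - t i

theorem coordWeight_nonneg {n : ℕ} {t : EuclideanSpace ℝ (Fin n)} (ht : t ∈ stdCube n) (i : Fin n)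
    (x : Bool) : 0 ≤ coordWeight t i x := by
  have := ht i
  rw [Set.mem_Icc] at this
  unfold coordWeight
  split_ifs <;> linarith

theorem coordWeight_not {n : ℕ} (t : EuclideanSpace ℝ (Fin n)) (i : Fin n) (x : Bool) :
    coordWeight t i (!x) = 1 - coordWeight t i x := by
  cases x <;> simp [coordWeight]

theorem coordWeight_le_add_dist {n : ℕ} (s t : EuclideanSpace ℝ (Fin n)) (i : Fin n) (x : Bool) :
    coordWeight t i x ≤ coordWeight s i x + dist s t := by
  have h : |s i - t i| ≤ dist s t := by
    rw [dist_eq_norm]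
    exact PiLp.norm_apply_le (s - t) i
  rw [abs_le] at h
  unfold coordWeight
  split_ifs <;> linarith

theorem sum_prod_coordWeight {n : ℕ} (t : EuclideanSpace ℝ (Fin n)) :
    ∑ a : Fin n → Bool, ∏ i, coordWeight t i (a i) = 1 := by
  rw [← Fintype.prod_sum fun i x => coordWeight t i x]
  simp [coordWeight]

theorem sum_facet_prod_coordWeight {n : ℕ} (t : EuclideanSpace ℝ (Fin n)) (i : Fin n) (x : Bool) :
    ∑ a : Fin n → Bool, (if a i = x then ∏ j, coordWeight t j (a j) else 0) =
      coordWeight t i x := by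
  -- Moving the condition into the `i`-th factor turns the sum over the facet into a product of
  -- sums, all equal to `1` except the `i`-th.
  have h : ∀ a : Fin n → Bool, (if a i = x then ∏ j, coordWeight t j (a j) else 0) =
      ∏ j, if j = i ∧ a j ≠ x then 0 else coordWeight t j (a j) := by
    intro a
    split_ifs with hx
    · refine Finset.prod_congr rfl fun j _ => ?_
      rw [if_neg]
      rintro ⟨rfl, hj⟩
      exact hj hx
    · symm
      refine Finset.prod_eq_zero (Finset.mem_univ i) ?_
      rw [if_pos ⟨rfl, hx⟩]
  simp_rw [h]
  rw [← Fintype.prod_sum fun j y => if j = i ∧ y ≠ x then 0 else coordWeight t j y,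
    Finset.prod_eq_single i]
  · cases x <;> simp
  · intro j _ hj
    simp [hj, coordWeight]
  · simp

section Mass

variable {V : Type*} {n : ℕ} {c : (Fin n → Bool) → V}

open Classical in
theorem mass_vertexWeight (hc : Function.Injective c) (t : EuclideanSpace ℝ (Fin n)) (F : Set V) :
    mass (vertexWeight c t) F =
      ∑ a : Fin n → Bool, if c a ∈ F then ∏ i, coordWeight t i (a i) else 0 := by
  have h0 : ∀ v, v ∉ Set.range c → vertexWeight c t v = 0 := fun v hv =>
    Function.extend_apply' _ _ _ hv
  have h1 : ∀ a, vertexWeight c t (c a) = ∏ i, coordWeight t i (a i) := fun a =>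
    hc.extend_apply _ _ a
  rw [mass, finsum_eq_sum_of_support_subset (s := Finset.univ.image c),
    Finset.sum_image fun a _ b _ h => hc h]
  · simp [Set.indicator_apply, h1]
  · intro v hv
    by_contra hv'
    refine hv ?_
    rw [Set.indicator_apply, h0 v (by simpa using hv'), ite_self]

theorem mass_vertexWeight_range (hc : Function.Injective c) (t : EuclideanSpace ℝ (Fin n)) :
    mass (vertexWeight c t) (Set.range c) = 1 := by
  rw [mass_vertexWeight hc, ← sum_prod_coordWeight t]
  simp

/-- Coordinates are thus read off from vertex weights, which is why depth can be defined without
charts. -/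
theorem mass_vertexWeight_facet (hc : Function.Injective c) (t : EuclideanSpace ℝ (Fin n))
    (i : Fin n) (x : Bool) :
    mass (vertexWeight c t) (c '' {b | b i = x}) = coordWeight t i x := by
  rw [mass_vertexWeight hc, ← sum_facet_prod_coordWeight t i x]
  refine Finset.sum_congr rfl fun a _ => ?_
  simp only [hc.mem_set_image, Set.mem_ofPred_eq]

theorem mass_vertexWeight_mono (hc : Function.Injective c) {t : EuclideanSpace ℝ (Fin n)}
    (ht : t ∈ stdCube n) {F G : Set V} (h : F ∩ Set.range c ⊆ G) :
    mass (vertexWeight c t) F ≤ mass (vertexWeight c t) G := by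
  rw [mass_vertexWeight hc, mass_vertexWeight hc]
  refine Finset.sum_le_sum fun a _ => ?_
  have h0 : 0 ≤ ∏ i, coordWeight t i (a i) :=
    Finset.prod_nonneg fun i _ => coordWeight_nonneg ht i _
  by_cases h1 : c a ∈ F
  · rw [if_pos h1, if_pos (h ⟨h1, Set.mem_range_self a⟩)]
  · rw [if_neg h1]
    split_ifs <;> simp [h0]

theorem mass_vertexWeight_le_one (hc : Function.Injective c) {t : EuclideanSpace ℝ (Fin n)}
    (ht : t ∈ stdCube n) (F : Set V) : mass (vertexWeight c t) F ≤ 1 := by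
  rw [← mass_vertexWeight_range hc t]
  exact mass_vertexWeight_mono hc ht Set.inter_subset_right

end Mass

/-! ### Depth of points and its change with distance. -/

namespace CubeComplex

variable {V : Type*} {X : CubeComplex V}

theorem facet_mem {C : Set V} {n : ℕ} {c : (Fin n → Bool) → V} (hc : IsCubeChart X.cubes C c)
    (i : Fin n) (x : Bool) : c '' {b | b i = x} ∈ X.cubes := by
  rw [hc.image_mem_iff]
  exact ⟨{i}, fun _ => x, by simp⟩

/-- `F ∩ C`, if nonempty, is a face of `C`; since it misses `a`, one of its fixed coordinates
disagrees with `a`. -/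
theorem eq_empty_or_exists_facet {C : Set V} (hC : C ∈ X.cubes) {n : ℕ} {c : (Fin n → Bool) → V}
    (hc : IsCubeChart X.cubes C c) {F : Set V} (hF : F ∈ X.cubes) {a : Fin n → Bool}
    (ha : c a ∉ F) :
    F ∩ Set.range c = ∅ ∨ ∃ i, F ∩ Set.range c ⊆ c '' {b | b i = !a i} := by
  rcases Set.eq_empty_or_nonempty (F ∩ Set.range c) with h | h
  · exact .inl h
  right
  have h1 : c '' (c ⁻¹' F) ∈ X.cubes := by
    rw [Set.image_preimage_eq_inter_range, hc.range_eq] at *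
    exact X.inter_mem F hF C hC h
  rw [hc.image_mem_iff] at h1
  obtain ⟨I, d, hI⟩ := h1
  have ha' : a ∉ c ⁻¹' F := ha
  simp only [hI, Set.mem_ofPred_eq, not_forall] at ha'
  obtain ⟨i, hi, hne⟩ := ha'
  refine ⟨i, ?_⟩
  rintro _ ⟨hb, b, rfl⟩
  refine ⟨b, ?_, rfl⟩
  have hb' : b ∈ c ⁻¹' F := hb
  rw [hI] at hb'
  rw [Set.mem_ofPred_eq, hb' i hi]
  revert hne
  cases a i <;> cases d i <;> simp

/-- Every cube that does not contain `v` carries at most the proportion `1 - r` of the weight of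
`p`. For a point `p` of a cube that contains `v` this says that `p` has distance at least `r` from
the faces of the cube that do not contain `v`. -/
def IsDeep (X : CubeComplex V) (v : V) (p : X.Realization) (r : ℝ) : Prop :=
  ∀ F ∈ X.cubes, v ∉ F → mass p.weight F ≤ 1 - r

theorem IsDeep.mono {v : V} {p : X.Realization} {r r' : ℝ} (h : X.IsDeep v p r) (hr : r' ≤ r) :
    X.IsDeep v p r' := fun F hF hv => (h F hF hv).trans (by linarith)

theorem IsDeep.mem {v : V} {p : X.Realization} {r : ℝ} (h : X.IsDeep v p r) (hr : 0 < r)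
    {C : Set V} (hC : C ∈ X.cubes) {n : ℕ} {c : (Fin n → Bool) → V}
    (hc : IsCubeChart X.cubes C c) {t : EuclideanSpace ℝ (Fin n)}
    (ht : p.weight = vertexWeight c t) : v ∈ C := by
  by_contra hv
  have := h C hC hv
  rw [ht, ← hc.range_eq, mass_vertexWeight_range hc.injective] at this
  linarith

theorem exists_isDeep (p : X.Realization) : ∃ v, X.IsDeep v p (1 / 2) := by
  obtain ⟨C, hC, n, c, hc, t, ht, hp⟩ := p.exists_cube
  -- The nearest corner: each coordinate is rounded, so every opposite facet has mass at most `1/2`.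
  refine ⟨c fun i => decide (1 / 2 ≤ t i), fun F hF hv => ?_⟩
  rw [hp]
  rcases eq_empty_or_exists_facet hC hc hF hv with h | ⟨i, h⟩
  · refine (mass_vertexWeight_mono hc.injective ht (G := ∅) h.le).trans ?_
    simp only [mass, Set.indicator_empty, finsum_zero]
    norm_num
  · refine (mass_vertexWeight_mono hc.injective ht h).trans ?_
    rw [mass_vertexWeight_facet hc.injective, coordWeight_not]
    unfold coordWeight
    by_cases h : 1 / 2 ≤ t i
    · simp only [h, decide_true, if_true]
      linarith
    · simp only [h, decide_false, Bool.false_eq_true, if_false]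
      linarith

/-- The mass of a facet is a single coordinate, hence 1-Lipschitz on the cube. When `r ≤ dist s t`
the vertex may lie outside `C`, but then the bound is at least `1`. -/
theorem IsDeep.of_cube {v : V} {p q : X.Realization} {r : ℝ} (h : X.IsDeep v p r) (hr : r ≤ 1)
    {C : Set V} (hC : C ∈ X.cubes) {n : ℕ} {c : (Fin n → Bool) → V}
    (hc : IsCubeChart X.cubes C c) {s t : EuclideanSpace ℝ (Fin n)} (ht : t ∈ stdCube n)
    (hp : p.weight = vertexWeight c s) (hq : q.weight = vertexWeight c t) :
    X.IsDeep v q (r - dist s t) := by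
  intro F hF hv
  rw [hq]
  rcases le_or_gt r (dist s t) with hd | hd
  · exact (mass_vertexWeight_le_one hc.injective ht F).trans (by linarith)
  have hvC : v ∈ C := h.mem (dist_nonneg.trans_lt hd) hC hc hp
  rw [← hc.range_eq] at hvC
  obtain ⟨a, rfl⟩ := hvC
  have hd0 : 0 ≤ dist s t := dist_nonneg
  rcases eq_empty_or_exists_facet hC hc hF hv with h' | ⟨i, h'⟩
  · refine (mass_vertexWeight_mono hc.injective ht (G := ∅) h'.le).trans ?_
    simp only [mass, Set.indicator_empty, finsum_zero]
    linarith
  · refine (mass_vertexWeight_mono hc.injective ht h').trans ?_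
    have h1 := h _ (facet_mem hc i (!a i)) (by simp [hc.injective.mem_set_image])
    rw [hp, mass_vertexWeight_facet hc.injective] at h1
    rw [mass_vertexWeight_facet hc.injective]
    linarith [coordWeight_le_add_dist s t i (!a i)]

theorem IsDeep.of_cubeDist_lt {v : V} {p q : X.Realization} {r e : ℝ} (h : X.IsDeep v p r)
    (hr : r ≤ 1) (he : X.cubeDist p q < ENNReal.ofReal e) : X.IsDeep v q (r - e) := by
  rw [cubeDist, sInf_lt_iff] at he
  obtain ⟨_, ⟨C, hC, n, c, hc, s, hs, t, ht, hp, hq, rfl⟩, hlt⟩ := he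
  refine (h.of_cube hr hC hc ht hp hq).mono ?_
  rw [edist_lt_ofReal] at hlt
  linarith

theorem IsDeep.of_sum_lt {v : V} {x : ℕ → X.Realization} {r : ℝ} (h : X.IsDeep v (x 0) r)
    (hr : r ≤ 1) (m : ℕ) {e : ℝ}
    (he : ∑ i ∈ Finset.range m, X.cubeDist (x i) (x (i + 1)) < ENNReal.ofReal e) :
    X.IsDeep v (x m) (r - e) := by
  induction m generalizing e with
  | zero =>
    refine h.mono ?_
    have := ENNReal.ofReal_pos.1 (pos_of_gt he)
    linarith
  | succ m ih =>
    rw [Finset.sum_range_succ] at he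
    set S := ∑ i ∈ Finset.range m, X.cubeDist (x i) (x (i + 1))
    have hfin := ENNReal.add_ne_top.1 (he.trans ENNReal.ofReal_lt_top).ne
    rw [← ENNReal.ofReal_toReal (ENNReal.add_ne_top.2 hfin), ENNReal.toReal_add hfin.1 hfin.2]
      at he
    have h1 := (ENNReal.ofReal_lt_ofReal_iff_of_nonneg
      (add_nonneg ENNReal.toReal_nonneg ENNReal.toReal_nonneg)).1 he
    set d := (X.cubeDist (x m) (x (m + 1))).toReal
    -- The slack in the strict inequality is shared equally, so that the two losses of depth add up
    -- to `e`.
    have hS : S < ENNReal.ofReal (S.toReal + (e - S.toReal - d) / 2) := by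
      rw [ENNReal.lt_ofReal_iff_toReal_lt hfin.1]
      linarith
    have hd : X.cubeDist (x m) (x (m + 1)) < ENNReal.ofReal (d + (e - S.toReal - d) / 2) := by
      rw [ENNReal.lt_ofReal_iff_toReal_lt hfin.2]
      linarith
    have hS0 : 0 ≤ S.toReal := ENNReal.toReal_nonneg
    have h2 := (ih hS).of_cubeDist_lt (by linarith) hd
    exact h2.mono (by linarith)

theorem IsDeep.of_dist_lt [MetricSpace X.Realization]
    (hX : ∀ p q : X.Realization, edist p q = X.lengthDist p q) {v : V} {p q : X.Realization}
    {r e : ℝ} (h : X.IsDeep v p r) (hr : r ≤ 1) (he : dist p q < e) : X.IsDeep v q (r - e) := by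
  rw [← edist_lt_ofReal, hX, lengthDist, sInf_lt_iff] at he
  obtain ⟨_, ⟨m, x, rfl, rfl, rfl⟩, hlt⟩ := he
  exact h.of_sum_lt hr m hlt

/-- One cube, depending on `q` alone, holds all the vertices at once: each keeps positive depth at
`q`, so any cube carrying `q` contains it. -/
theorem exists_cube_of_dist_lt [MetricSpace X.Realization]
    (hX : ∀ p q : X.Realization, edist p q = X.lengthDist p q) (q : X.Realization) :
    ∃ C ∈ X.cubes, ∀ (v : V) (p : X.Realization), X.IsDeep v p (1 / 2) → dist p q < 1 / 2 →
      v ∈ C := by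
  obtain ⟨C, hC, n, c, hc, t, ht, hq⟩ := q.exists_cube
  refine ⟨C, hC, fun v p hv hd => ?_⟩
  obtain ⟨e, he, he'⟩ := exists_between hd
  exact (hv.of_dist_lt hX (by norm_num) he).mem (by linarith) hC hc hq

/-- The vector of coordinates of a vertex of the standard cube. -/
noncomputable def cornerPoint {n : ℕ} (a : Fin n → Bool) : EuclideanSpace ℝ (Fin n) :=
  WithLp.toLp 2 fun i => if a i = true then 1 else 0

theorem cornerPoint_mem {n : ℕ} (a : Fin n → Bool) : cornerPoint a ∈ stdCube n := by
  intro i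
  simp only [cornerPoint]
  split_ifs <;> simp

open Classical in
theorem vertexWeight_cornerPoint {n : ℕ} {c : (Fin n → Bool) → V} (hc : Function.Injective c)
    (a : Fin n → Bool) : vertexWeight c (cornerPoint a) = Pi.single (c a) 1 := by
  ext v
  by_cases hv : v ∈ Set.range c
  · obtain ⟨b, rfl⟩ := hv
    rw [vertexWeight, hc.extend_apply, Pi.single_apply]
    split_ifs with hab
    · rw [hc hab]
      refine Finset.prod_eq_one fun i _ => ?_
      cases h : a i <;> simp [cornerPoint, h]
    · obtain ⟨i, hi⟩ := Function.ne_iff.1 fun h : b = a => hab (congrArg c h)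
      refine Finset.prod_eq_zero (Finset.mem_univ i) ?_
      revert hi
      cases h : a i <;> cases h' : b i <;> simp [cornerPoint, h]
  · rw [vertexWeight, Function.extend_apply' _ _ _ hv, Pi.single_apply, if_neg]
    · rfl
    · rintro rfl
      exact hv ⟨a, rfl⟩

open Classical in
/-- A vertex, as a point of the geometric realization. -/
noncomputable def vertexPoint (X : CubeComplex V) (v : V) : X.Realization where
  weight := Pi.single v 1
  exists_cube := by
    obtain ⟨n, c, hc⟩ := X.exists_chart {v} (X.singleton_mem v)
    obtain ⟨a, rfl⟩ : v ∈ Set.range c := by rw [hc.range_eq]; rfl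
    exact ⟨_, X.singleton_mem _, n, c, hc, cornerPoint a, cornerPoint_mem a,
      (vertexWeight_cornerPoint hc.injective a).symm⟩

open Classical in
theorem isDeep_vertexPoint (v : V) : X.IsDeep v (X.vertexPoint v) 1 := by
  intro F _ hv
  have : F.indicator (X.vertexPoint v).weight = 0 := by
    ext w
    rw [Set.indicator_apply]
    split_ifs with hw
    · have : w ≠ v := by
        rintro rfl
        exact hv hw
      simp [vertexPoint, this]
    · rfl
  simp [mass, this]

theorem dist_vertexPoint_le [MetricSpace X.Realization]
    (hX : ∀ p q : X.Realization, edist p q = X.lengthDist p q) {u v : V}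
    (h : X.edgeGraph.Adj u v) : dist (X.vertexPoint u) (X.vertexPoint v) ≤ 1 := by
  obtain ⟨n, c, hc⟩ := X.exists_chart _ h.1
  obtain ⟨a, rfl⟩ : u ∈ Set.range c := by rw [hc.range_eq]; simp
  obtain ⟨b, rfl⟩ : v ∈ Set.range c := by rw [hc.range_eq]; simp
  obtain ⟨i, rfl⟩ := exists_flipAt_of_adj hc h
  have h1 : X.lengthDist (X.vertexPoint (c a)) (X.vertexPoint (c (flipAt i a))) ≤
      X.cubeDist (X.vertexPoint (c a)) (X.vertexPoint (c (flipAt i a))) :=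
    sInf_le ⟨1, fun k => if k = 0 then X.vertexPoint (c a) else X.vertexPoint (c (flipAt i a)),
      by simp, by simp, by simp⟩
  have h2 : X.cubeDist (X.vertexPoint (c a)) (X.vertexPoint (c (flipAt i a))) ≤
      edist (cornerPoint a) (cornerPoint (flipAt i a)) :=
    sInf_le ⟨_, h.1, n, c, hc, _, cornerPoint_mem _, _, cornerPoint_mem _,
      (vertexWeight_cornerPoint hc.injective _).symm,
      (vertexWeight_cornerPoint hc.injective _).symm, rfl⟩
  have h3 : dist (cornerPoint a) (cornerPoint (flipAt i a)) ≤ 1 := by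
    rw [EuclideanSpace.dist_eq, Finset.sum_eq_single i]
    · cases h : a i <;> simp [cornerPoint, flipAt_same, h]
    · intro j _ hj
      simp [cornerPoint, flipAt_of_ne hj]
    · simp
  rw [← hX, edist_dist] at h1
  rw [edist_dist] at h2
  have h4 := h1.trans h2
  rw [ENNReal.ofReal_le_ofReal_iff dist_nonneg] at h4
  exact h4.trans h3

end CubeComplex

/-! ### Comparison triangles and geodesics with a common start. -/

theorem exists_euclidean_triangle {a b c : ℝ} (ha : 0 ≤ a) (hb : 0 ≤ b) (hc : 0 ≤ c)
    (hab : a ≤ b + c) (hba : b ≤ a + c) (habc : c ≤ a + b) :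
    ∃ x y z : EuclideanSpace ℝ (Fin 2), dist x y = a ∧ dist x z = b ∧ dist y z = c := by
  rcases ha.eq_or_lt with rfl | ha
  · obtain rfl : b = c := by linarith
    refine ⟨0, 0, !₂[b, 0], by simp, ?_, ?_⟩ <;>
      simp [EuclideanSpace.dist_eq, Real.sqrt_sq_eq_abs, abs_of_nonneg hb]
  -- First coordinate of the third vertex, from the law of cosines.
  set d := (a ^ 2 + b ^ 2 - c ^ 2) / (2 * a) with hd
  have hda : 2 * a * d = a ^ 2 + b ^ 2 - c ^ 2 := by
    rw [hd]
    field_simp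
  have h1 : d ≤ b := by
    rw [hd, div_le_iff₀ (by linarith)]
    nlinarith
  have h2 : -b ≤ d := by
    rw [hd, le_div_iff₀ (by linarith)]
    nlinarith
  have h3 : 0 ≤ b ^ 2 - d ^ 2 := by nlinarith
  refine ⟨0, !₂[a, 0], !₂[d, √(b ^ 2 - d ^ 2)], ?_, ?_, ?_⟩
  · simp [EuclideanSpace.dist_eq, Real.sqrt_sq_eq_abs, abs_of_pos ha]
  · rw [EuclideanSpace.dist_eq, Real.sqrt_eq_iff_eq_sq (by positivity) hb]
    simp [Real.dist_eq, Real.sq_sqrt h3]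
  · rw [EuclideanSpace.dist_eq, Real.sqrt_eq_iff_eq_sq (by positivity) hc]
    simp [Real.dist_eq, Real.sq_sqrt h3]
    linarith [sq_nonneg a]

theorem IsCAT0Space.dist_geodesic_le {α : Type*} [MetricSpace α] (h : IsCAT0Space α) {x y z : α}
    {γ δ : ℝ → α} (hγ : IsGeodesicFromTo x y γ) (hδ : IsGeodesicFromTo x z δ) {s : ℝ}
    (hs : s ∈ Set.Icc (0 : ℝ) 1) : dist (γ s) (δ s) ≤ dist y z := by
  obtain ⟨x', y', z', hxy, hxz, hyz⟩ := exists_euclidean_triangle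
    (dist_nonneg (x := x) (y := y)) (dist_nonneg (x := x) (y := z)) (dist_nonneg (x := y) (y := z))
    (by rw [dist_comm y z]; exact dist_triangle x z y) (dist_triangle x y z)
    (by rw [dist_comm x y]; exact dist_triangle y x z)
  refine (h.comparison x y z γ δ hγ hδ x' y' z' hxy hxz hyz s hs s hs).trans ?_
  have h1 : AffineMap.lineMap x' y' s - AffineMap.lineMap x' z' s = s • (y' - z') := by
    simp only [AffineMap.lineMap_apply, vsub_eq_sub, vadd_eq_add]
    module
  rw [dist_eq_norm, h1, norm_smul, ← dist_eq_norm, hyz, Real.norm_of_nonneg hs.1]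
  exact mul_le_of_le_one_left dist_nonneg hs.2

/-! ### Walks that track geodesics. -/

namespace CubeComplex

section Tracking

variable {V : Type*} {X : CubeComplex V}

/-- The walk `p` runs from `x` to `v 0`, …, `v k`, and stays in a single cube in between. -/
def Follows (x : V) (v : ℕ → V) : (k : ℕ) → X.edgeGraph.Walk x (v k) → Prop
  | 0, p => IsCubeWalk p
  | k + 1, p => ∃ (p' : X.edgeGraph.Walk x (v k)) (e : X.edgeGraph.Walk (v k) (v (k + 1))),
      Follows x v k p' ∧ IsCubeWalk e ∧ p = p'.append e

theorem exists_follows {x : V} {v : ℕ → V} {k : ℕ} (h0 : ∃ C ∈ X.cubes, x ∈ C ∧ v 0 ∈ C)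
    (h : ∀ i < k, ∃ C ∈ X.cubes, v i ∈ C ∧ v (i + 1) ∈ C) :
    ∃ p : X.edgeGraph.Walk x (v k), Follows x v k p := by
  induction k with
  | zero =>
    obtain ⟨C, hC, hx, hv⟩ := h0
    exact exists_isCubeWalk hC hx hv
  | succ k ih =>
    obtain ⟨p, hp⟩ := ih fun i hi => h i (by omega)
    obtain ⟨C, hC, hv, hv'⟩ := h k (by omega)
    obtain ⟨e, he⟩ := exists_isCubeWalk hC hv hv'
    exact ⟨_, p, e, hp, he, rfl⟩

/-- A ladder argument: the diagonal from `v i` to `w (i + 1)` cuts each quadrilateral into two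
triangles, each contained in a cube. -/
theorem Follows.walkHomotopic {x : V} {v w : ℕ → V} {k : ℕ}
    (h0 : ∃ C ∈ X.cubes, x ∈ C ∧ v 0 ∈ C ∧ w 0 ∈ C)
    (h₁ : ∀ i < k, ∃ C ∈ X.cubes, v i ∈ C ∧ v (i + 1) ∈ C ∧ w (i + 1) ∈ C)
    (h₂ : ∀ i < k, ∃ C ∈ X.cubes, v i ∈ C ∧ w i ∈ C ∧ w (i + 1) ∈ C)
    {p : X.edgeGraph.Walk x (v k)} {q : X.edgeGraph.Walk x (w k)} {r : X.edgeGraph.Walk (v k) (w k)}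
    (hp : Follows x v k p) (hq : Follows x w k q) (hr : IsCubeWalk r) :
    X.WalkHomotopic (p.append r) q := by
  induction k with
  | zero =>
    obtain ⟨C, hC, hx, hv, hw⟩ := h0
    exact IsCubeWalk.append_walkHomotopic hC hx hv hw hp hr hq
  | succ k ih =>
    obtain ⟨p, e, hp, he, rfl⟩ := hp
    obtain ⟨q, f, hq, hf, rfl⟩ := hq
    obtain ⟨C, hC, hC1, hC2, hC3⟩ := h₁ k (by omega)
    obtain ⟨D, hD, hD1, hD2, hD3⟩ := h₂ k (by omega)
    obtain ⟨s, hs⟩ := exists_isCubeWalk hD hD1 hD2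
    obtain ⟨d, hd⟩ := exists_isCubeWalk hD hD1 hD3
    have ih' := ih (fun i hi => h₁ i (by omega)) (fun i hi => h₂ i (by omega)) hp hq hs
    have h1 := (IsCubeWalk.append_walkHomotopic hC hC1 hC2 hC3 he hr hd).append_left p
    have h2 := (IsCubeWalk.append_walkHomotopic hD hD1 hD2 hD3 hs hf hd).append_left p
    rw [SimpleGraph.Walk.append_assoc] at h1 h2
    exact h1.trans (h2.symm.trans (ih'.append_right f))

/-- The walk `p` stays close to a geodesic from the vertex `x` to the point `q`, sampled at
`N` equidistant times. -/
def IsTracked [MetricSpace X.Realization] (N : ℕ) (q : X.Realization) {x v : V}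
    (p : X.edgeGraph.Walk x v) : Prop :=
  ∃ (γ : ℝ → X.Realization) (vs : ℕ → V) (p' : X.edgeGraph.Walk x (vs N))
    (r : X.edgeGraph.Walk (vs N) v),
    IsGeodesicFromTo (X.vertexPoint x) q γ ∧ (∀ i : ℕ, X.IsDeep (vs i) (γ (i / N)) (1 / 2)) ∧
      Follows x vs N p' ∧ IsCubeWalk r ∧ X.WalkHomotopic (p'.append r) p

/-- The bound `1/6` is what remains of the radius `1/2` after the `1/3` between neighbouring
geodesics. -/
theorem dist_geodesic_step {α : Type*} [MetricSpace α] {x y : α} {γ : ℝ → α}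
    (hγ : IsGeodesicFromTo x y γ) {N i : ℕ} (hi : i < N) (hN : 6 * dist x y < N) :
    dist (γ (i / N)) (γ ((i + 1 : ℕ) / N)) < 1 / 6 := by
  have hN0 : (0 : ℝ) < N := by exact_mod_cast (show 0 < N by omega)
  have hi' : (i : ℝ) + 1 ≤ N := by exact_mod_cast hi
  rw [hγ.dist_eq _ ⟨by positivity, by rw [div_le_one hN0]; linarith⟩ _
    ⟨by positivity, by rw [div_le_one hN0]; push_cast; exact hi'⟩]
  have : |(i : ℝ) / N - (i + 1 : ℕ) / N| = 1 / N := by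
    rw [← sub_div, abs_div, abs_of_pos hN0]
    push_cast
    simp
  rw [this, one_div_mul_eq_div, div_lt_iff₀ hN0]
  linarith

variable [MetricSpace X.Realization]

theorem exists_isTracked (hX : ∀ p q : X.Realization, edist p q = X.lengthDist p q)
    (hcat : IsCAT0Space X.Realization) {N : ℕ} {q : X.Realization} {x v : V}
    (hN : 6 * dist (X.vertexPoint x) q < N) (hv : X.IsDeep v q (1 / 2)) :
    ∃ p : X.edgeGraph.Walk x v, IsTracked N q p := by
  obtain ⟨γ, hγ⟩ := hcat.exists_geodesic (X.vertexPoint x) q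
  have hN0 : (N : ℝ) ≠ 0 := (lt_of_le_of_lt (by positivity) hN).ne'
  -- Indices beyond `N` are harmless: every point has a deep vertex, whatever `γ` does outside
  -- `[0,1]`.
  choose vs hvs using fun i : ℕ => exists_isDeep (γ (i / N))
  obtain ⟨p', hp'⟩ := exists_follows (X := X) (x := x) (v := vs) (k := N) (by
      obtain ⟨C, hC, h⟩ := exists_cube_of_dist_lt hX (X.vertexPoint x)
      refine ⟨C, hC, h x _ ((isDeep_vertexPoint x).mono (by norm_num)) (by simp), h _ _ (hvs 0) ?_⟩
      simp [hγ.map_zero])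
    (by
      intro i hi
      obtain ⟨C, hC, h⟩ := exists_cube_of_dist_lt hX (γ ((i + 1 : ℕ) / N))
      refine ⟨C, hC, h _ _ (hvs i) ?_, h _ _ (hvs (i + 1)) (by simp)⟩
      linarith [dist_geodesic_step hγ hi hN])
  obtain ⟨C, hC, h⟩ := exists_cube_of_dist_lt hX q
  obtain ⟨r, hr⟩ := exists_isCubeWalk hC
    (h _ _ (hvs N) (by rw [div_self hN0, hγ.map_one, dist_self]; norm_num))
    (h _ _ hv (by simp))
  exact ⟨p'.append r, γ, vs, p', r, hγ, hvs, hp', hr, .refl _⟩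

theorem IsTracked.walkHomotopic (hX : ∀ p q : X.Realization, edist p q = X.lengthDist p q)
    (hcat : IsCAT0Space X.Realization) {N : ℕ} {y z : X.Realization} {x v w : V}
    (hy : 6 * dist (X.vertexPoint x) y < N) (hyz : dist y z ≤ 1 / 3)
    (hv : X.IsDeep v y (1 / 2)) (hw : X.IsDeep w z (1 / 2))
    {p : X.edgeGraph.Walk x v} {q : X.edgeGraph.Walk x w} {r : X.edgeGraph.Walk v w}
    (hp : IsTracked N y p) (hq : IsTracked N z q) (hr : IsCubeWalk r) :
    X.WalkHomotopic (p.append r) q := by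
  obtain ⟨γ, vs, p', a, hγ, hvs, hp', ha, hpa⟩ := hp
  obtain ⟨δ, ws, q', b, hδ, hws, hq', hb, hqb⟩ := hq
  have hN0 : (0 : ℝ) < N := lt_of_le_of_lt (by positivity) hy
  have hclose : ∀ i ≤ N, dist (γ (i / N)) (δ (i / N)) ≤ 1 / 3 := fun i hi =>
    (hcat.dist_geodesic_le hγ hδ ⟨by positivity, by
      rw [div_le_one hN0]
      exact_mod_cast hi⟩).trans hyz
  have hcross : ∀ i < N, dist (γ (i / N)) (δ ((i + 1 : ℕ) / N)) < 1 / 2 := fun i hi => by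
    linarith [dist_triangle (γ (i / N)) (γ ((i + 1 : ℕ) / N)) (δ ((i + 1 : ℕ) / N)),
      hclose (i + 1) hi, dist_geodesic_step hγ hi hy]
  obtain ⟨D, hD, h⟩ := exists_cube_of_dist_lt hX z
  have hvN : vs N ∈ D := h _ _ (hvs N) (by
    rw [div_self hN0.ne', hγ.map_one]
    linarith)
  have hwN : ws N ∈ D := h _ _ (hws N) (by
    rw [div_self hN0.ne', hδ.map_one, dist_self]
    norm_num)
  have hvD : v ∈ D := h _ _ hv (by linarith)
  have hwD : w ∈ D := h _ _ hw (by simp)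
  obtain ⟨s, hs⟩ := exists_isCubeWalk hD hvN hwN
  obtain ⟨d, hd⟩ := exists_isCubeWalk hD hvN hwD
  have hmain : X.WalkHomotopic (p'.append s) q' := by
    refine Follows.walkHomotopic ?_ ?_ ?_ hp' hq' hs
    · obtain ⟨C, hC, h⟩ := exists_cube_of_dist_lt hX (X.vertexPoint x)
      refine ⟨C, hC, h x _ ((isDeep_vertexPoint x).mono (by norm_num)) (by simp),
        h _ _ (hvs 0) ?_, h _ _ (hws 0) ?_⟩
      · simp [hγ.map_zero]
      · simp [hδ.map_zero]
    -- This triangle lies in the cube chosen for `δ ((i + 1) / N)`, the next one in the cube chosen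
    -- for `γ (i / N)`.
    · intro i hi
      obtain ⟨C, hC, h⟩ := exists_cube_of_dist_lt hX (δ ((i + 1 : ℕ) / N))
      refine ⟨C, hC, h _ _ (hvs i) (hcross i hi), h _ _ (hvs (i + 1)) ?_,
        h _ _ (hws (i + 1)) (by simp)⟩
      linarith [hclose (i + 1) hi]
    · intro i hi
      obtain ⟨C, hC, h⟩ := exists_cube_of_dist_lt hX (γ (i / N))
      refine ⟨C, hC, h _ _ (hvs i) (by simp), h _ _ (hws i) ?_, h _ _ (hws (i + 1)) ?_⟩
      · rw [dist_comm]
        linarith [hclose i hi.le]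
      · rw [dist_comm]
        exact hcross i hi
  have h1 := (IsCubeWalk.append_walkHomotopic hD hvN hvD hwD ha hr hd).append_left p'
  have h2 := (IsCubeWalk.append_walkHomotopic hD hvN hwN hwD hs hb hd).append_left p'
  rw [SimpleGraph.Walk.append_assoc] at h1 h2
  exact (hpa.append_right r).symm.trans
    (h1.trans (h2.symm.trans ((hmain.append_right b).trans hqb)))

/-- Adjacent vertices can be too far apart for a single comparison, so a geodesic between them is
cut into thirds. The vertex `u` is still deep at the first cut and `v` already at the second, so the
edge is crossed in the middle third. The `+ 1` in `hN` covers both cut points. -/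
theorem IsTracked.walkHomotopic_of_adj
    (hX : ∀ p q : X.Realization, edist p q = X.lengthDist p q)
    (hcat : IsCAT0Space X.Realization) {N : ℕ} {x u v : V}
    (hN : 6 * (dist (X.vertexPoint x) (X.vertexPoint u) + 1) < N)
    (h : X.edgeGraph.Adj u v) {p : X.edgeGraph.Walk x u} {q : X.edgeGraph.Walk x v}
    (hp : IsTracked N (X.vertexPoint u) p) (hq : IsTracked N (X.vertexPoint v) q) :
    X.WalkHomotopic (p.append (.cons h .nil)) q := by
  obtain ⟨γ, hγ⟩ := hcat.exists_geodesic (X.vertexPoint u) (X.vertexPoint v)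
  have hd := dist_vertexPoint_le hX h
  have hd0 : 0 ≤ dist (X.vertexPoint u) (X.vertexPoint v) := dist_nonneg
  have h01 : dist (X.vertexPoint u) (γ (1 / 3)) ≤ 1 / 3 := by
    rw [← hγ.map_zero, hγ.dist_eq _ (by norm_num) _ (by norm_num)]
    norm_num [abs_of_pos]
    linarith
  have h12 : dist (γ (1 / 3)) (γ (2 / 3)) ≤ 1 / 3 := by
    rw [hγ.dist_eq _ (by norm_num) _ (by norm_num)]
    norm_num [abs_of_pos]
    linarith
  have h23 : dist (γ (2 / 3)) (X.vertexPoint v) ≤ 1 / 3 := by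
    rw [← hγ.map_one, hγ.dist_eq _ (by norm_num) _ (by norm_num)]
    norm_num [abs_of_pos]
    linarith
  have t1 := dist_triangle (X.vertexPoint x) (X.vertexPoint u) (γ (1 / 3))
  have t2 := dist_triangle (X.vertexPoint x) (γ (1 / 3)) (γ (2 / 3))
  have du : X.IsDeep u (X.vertexPoint u) (1 / 2) := (isDeep_vertexPoint u).mono (by norm_num)
  have dv : X.IsDeep v (X.vertexPoint v) (1 / 2) := (isDeep_vertexPoint v).mono (by norm_num)
  have d1 : X.IsDeep u (γ (1 / 3)) (1 / 2) :=
    ((isDeep_vertexPoint u).of_dist_lt hX le_rfl (e := 1 / 2) (by linarith)).mono (by norm_num)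
  have d2 : X.IsDeep v (γ (2 / 3)) (1 / 2) :=
    ((isDeep_vertexPoint v).of_dist_lt hX le_rfl (e := 1 / 2)
      (by rw [dist_comm]; linarith)).mono (by norm_num)
  have hn1 : 6 * dist (X.vertexPoint x) (γ (1 / 3)) < N := by linarith
  have hn2 : 6 * dist (X.vertexPoint x) (γ (2 / 3)) < N := by linarith
  obtain ⟨p₁, hp₁⟩ := exists_isTracked hX hcat hn1 d1
  obtain ⟨p₂, hp₂⟩ := exists_isTracked hX hcat hn2 d2
  have hnil : ∀ z : V, IsCubeWalk (X := X) (.nil : X.edgeGraph.Walk z z) := fun z =>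
    ⟨{z}, X.singleton_mem z, by simp⟩
  have hcons : IsCubeWalk (X := X) (.cons h .nil : X.edgeGraph.Walk u v) :=
    ⟨{u, v}, h.1, by simp⟩
  have e1 := hp.walkHomotopic hX hcat (by linarith) h01 du d1 hp₁ (hnil u)
  have e2 := hp₁.walkHomotopic hX hcat hn1 h12 d1 d2 hp₂ hcons
  have e3 := hp₂.walkHomotopic hX hcat hn2 h23 d2 dv hq (hnil v)
  rw [SimpleGraph.Walk.append_nil] at e1 e3
  exact (e1.append_right _).trans (e2.trans e3)

theorem IsTracked.walkHomotopic_append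
    (hX : ∀ p q : X.Realization, edist p q = X.lengthDist p q)
    (hcat : IsCAT0Space X.Realization) {N : ℕ} {x u v : V} (e : X.edgeGraph.Walk u v)
    (hN : ∀ z ∈ e.support, 6 * (dist (X.vertexPoint x) (X.vertexPoint z) + 1) < N)
    {p : X.edgeGraph.Walk x u} {q : X.edgeGraph.Walk x v}
    (hp : IsTracked N (X.vertexPoint u) p) (hq : IsTracked N (X.vertexPoint v) q) :
    X.WalkHomotopic (p.append e) q := by
  -- A tracked walk depends, up to homotopy, neither on the geodesic nor on the rounding.
  have hself : ∀ {z : V} {p q : X.edgeGraph.Walk x z},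
      6 * dist (X.vertexPoint x) (X.vertexPoint z) < N →
      IsTracked N (X.vertexPoint z) p → IsTracked N (X.vertexPoint z) q →
      X.WalkHomotopic p q := by
    intro z p q hz hp hq
    have dz : X.IsDeep z (X.vertexPoint z) (1 / 2) := (isDeep_vertexPoint z).mono (by norm_num)
    have := hp.walkHomotopic hX hcat hz (by simp) dz dz hq (r := .nil)
      ⟨{z}, X.singleton_mem z, by simp⟩
    rwa [SimpleGraph.Walk.append_nil] at this
  induction e with
  | nil =>
    rw [SimpleGraph.Walk.append_nil]
    exact hself (by linarith [hN _ (SimpleGraph.Walk.start_mem_support _)]) hp hq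
  | @cons u z v h e ih =>
    have hu := hN u (by simp)
    have hz := hN z (by simp)
    have hz' : 6 * dist (X.vertexPoint x) (X.vertexPoint z) < N := by linarith
    obtain ⟨p', hp'⟩ := exists_isTracked hX hcat hz'
      ((isDeep_vertexPoint z).mono (by norm_num : (1 / 2 : ℝ) ≤ 1))
    have h1 := ih (fun y hy => hN y (by simp [hy])) hp' hq
    have h2 := (hp.walkHomotopic_of_adj hX hcat hu h hp').append_right e
    rw [← SimpleGraph.Walk.append_assoc, SimpleGraph.Walk.cons_append,
      SimpleGraph.Walk.nil_append] at h2
    exact h2.trans h1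

end Tracking

/-! ### Conclusion. -/

theorem IsCAT0.walkHomotopic {V : Type*} {X : CubeComplex V} (hX : X.IsCAT0) {x y : V}
    (p q : X.edgeGraph.Walk x y) : X.WalkHomotopic p q := by
  obtain ⟨_, hdist, hcat⟩ := hX
  obtain ⟨M, hM⟩ := ((p.support ++ q.support).finite_toSet.image
    fun z => dist (X.vertexPoint x) (X.vertexPoint z)).bddAbove
  -- A single sampling number must serve all vertices of both walks.
  obtain ⟨N, hN⟩ := exists_nat_gt (6 * (M + 1))
  have hbound : ∀ z ∈ p.support ++ q.support,
      6 * (dist (X.vertexPoint x) (X.vertexPoint z) + 1) < N := fun z hz => by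
    have : dist (X.vertexPoint x) (X.vertexPoint z) ≤ M := hM ⟨z, hz, rfl⟩
    linarith
  have hx := hbound x (by simp)
  have hy := hbound y (by simp)
  have half : (1 / 2 : ℝ) ≤ 1 := by norm_num
  -- The loop `p₀` need not be trivial; it is cancelled at the end.
  obtain ⟨p₀, hp₀⟩ := exists_isTracked hdist hcat (by linarith) ((isDeep_vertexPoint x).mono half)
  obtain ⟨r, hr⟩ := exists_isTracked hdist hcat (by linarith) ((isDeep_vertexPoint y).mono half)
  have h1 := hp₀.walkHomotopic_append hdist hcat p (fun z hz => hbound z (by simp [hz])) hr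
  have h2 := hp₀.walkHomotopic_append hdist hcat q (fun z hz => hbound z (by simp [hz])) hr
  exact (h1.trans h2.symm).of_append_left

end CubeComplex

theorem mainTheorem8 {V : Type*} (X : CubeComplex V) (hX : X.IsCAT0) {x y : V}
    (p q : X.EdgePath x y) :
    Relation.EqvGen (fun p q : X.EdgePath x y => X.CornerMove p q ∨ X.SimpleCancellation p q) p q := by
  obtain ⟨p, rfl⟩ := CubeComplex.exists_walkEdgePath_eq p
  obtain ⟨q, rfl⟩ := CubeComplex.exists_walkEdgePath_eq q
  exact (hX.walkHomotopic p q).eqvGen
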